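/- Let $n\ge 1$. Write points of $\mathbb R^{4n}$ as $(x_i,y_i,z_i,w_i)_{1\le i\le n}$ and let $\rho=(\rho_1,\rho_2,\rho_3)$ be the $\mathbb R^3$-valued $2$-form on $\mathbb R^{4n}$ with $$\rho_1=\sum_i dx_i\wedge dy_i+dz_i\wedge dw_i,\quad \rho_2=\sum_i dx_i\wedge dz_i+dw_i\wedge dy_i,\quad \rho_3=\sum_i dx_i\wedge dw_i+dy_i\wedge dz_i .$$ Let $\mathbb H_{\mathbb H}^n=\mathbb R^{4n}\times\mathbb R^3$ be the quaternionic Heisenberg group, with product $(a,s)(b,t)=(a+b,\,s+t+\tfrac12\rho(a,b))$, projection $\pi(a,s)=a$, dilations $\delta_r(a,s)=(ra,r^2s)$ and, for $w\in\mathbb R^{4n}$, left-invariant horizontal vector field $X_w(a,s)=(w,\tfrac12\rho(a,w))$. Let $1\le p\le\infty$. Let $f:\mathbb R^{4n}\to\mathbb R^{4n}$ be continuous and of class $W^{1,p}_{loc}$, and suppose that $f$ admits a Sobolev contact lift $F:\mathbb H_{\mathbb H}^n\to\mathbb H_{\mathbb H}^n$. That is: $\pi\circ F=f\circ\pi$;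 the coordinates of $F$ and their weak derivatives along every $X_w$ belong to $L^p_{loc}$; and, for every $w$, the weak derivative $X_wF(g)$ is a horizontal vector at $F(g)$ for almost every $g$. Suppose that at almost every $g\in\mathbb H_{\mathbb H}^n$ (for instance, at every $g$) $F$ is Pansu differentiable with differential $D_PF(g)$ of full rank. That is, there is a bijective group homomorphism $L=D_PF(g)$ of $\mathbb H_{\mathbb H}^n$ that commutes with the dilations $\delta_r$, $r>0$, and satisfies $\delta_{1/r}\big(F(g)^{-1}F(g\,\delta_r h)\big)\to L(h)$ as $r\to0^+$, uniformly for $h$ in compact sets. Then $f$ is an affine transformation: there are an invertible linear map $A$ of $\mathbb R^{4n}$ and $b\in\mathbb R^{4n}$ with $f(x)=Ax+b$ for all $x$. Moreover there is an invertible linear map $\varphi$ of $\mathbb R^3$ with $\rho(Av,Aw)=\varphi(\rho(v,w))$ for all $v,w$; and for all $x,q\in\mathbb R^{4n}$ the map $Df(x)\,Df(q)^{-1}$ is orthogonal and preserves $\rho_1,\rho_2,\rho_3$. -/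

import Mathlib

open MeasureTheory Filter Topology
open scoped ENNReal ContDiff

noncomputable section

namespace QuatHeis

/-- `ℝ^{4n}`, with coordinates `x_i = v (i, 0)`, `y_i = v (i, 1)`, `z_i = v (i, 2)`,
`w_i = v (i, 3)`, `i = 1, …, n`, and the Euclidean norm. -/
abbrev Hor (n : ℕ) : Type := EuclideanSpace ℝ (Fin n × Fin 4)

/-- The centre `ℝ³` of the quaternionic Heisenberg group. -/
abbrev Ver : Type := EuclideanSpace ℝ (Fin 3)

variable {n : ℕ}

/-- The `ℝ³`-valued 2-form `ρ = (ρ₁, ρ₂, ρ₃)` on `ℝ^{4n}`, where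
`ρ₁ = ∑ dx_i ∧ dy_i + dz_i ∧ dw_i`, `ρ₂ = ∑ dx_i ∧ dz_i + dw_i ∧ dy_i`,
`ρ₃ = ∑ dx_i ∧ dw_i + dy_i ∧ dz_i`. -/
def rho (a b : Hor n) : Ver :=
  !₂[∑ i, ((a (i, 0) * b (i, 1) - a (i, 1) * b (i, 0))
        + (a (i, 2) * b (i, 3) - a (i, 3) * b (i, 2))),
     ∑ i, ((a (i, 0) * b (i, 2) - a (i, 2) * b (i, 0))
        + (a (i, 3) * b (i, 1) - a (i, 1) * b (i, 3))),
     ∑ i, ((a (i, 0) * b (i, 3) - a (i, 3) * b (i, 0))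
        + (a (i, 1) * b (i, 2) - a (i, 2) * b (i, 1)))]

theorem rho_add_left (a b c : Hor n) : rho (a + b) c = rho a c + rho b c := by
  ext k
  fin_cases k <;> simp [rho, ← Finset.sum_add_distrib] <;>
    exact Finset.sum_congr rfl fun i _ => by ring

theorem rho_add_right (a b c : Hor n) : rho a (b + c) = rho a b + rho a c := by
  ext k
  fin_cases k <;> simp [rho, ← Finset.sum_add_distrib] <;>
    exact Finset.sum_congr rfl fun i _ => by ring

theorem rho_zero_left (a : Hor n) : rho 0 a = 0 := by
  ext k
  fin_cases k <;> simp [rho]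

theorem rho_zero_right (a : Hor n) : rho a 0 = 0 := by
  ext k
  fin_cases k <;> simp [rho]

theorem rho_neg_self (a : Hor n) : rho (-a) a = 0 := by
  ext k
  fin_cases k <;> simp [rho] <;>
    exact Finset.sum_eq_zero fun i _ => by ring

/-- The quaternionic Heisenberg group in exponential coordinates: the simply connected Lie group
whose Lie algebra is the central extension `ℝ^{4n} ⊕ ℝ³` of the abelian Lie algebra `ℝ^{4n}` by
`ρ`, that is, `[(a, s), (b, t)] = (0, ρ(a, b))`. -/
def QHeis (n : ℕ) : Type := Hor n × Ver

/- Topology, smooth structure and Lebesgue (= Haar) measure are those of `ℝ^{4n} × ℝ³`.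
The additive structure is that of the Lie algebra, which exponential coordinates identify with the
group; the group law is the multiplicative one below. -/
instance : NormedAddCommGroup (QHeis n) := inferInstanceAs (NormedAddCommGroup (Hor n × Ver))
instance : NormedSpace ℝ (QHeis n) := inferInstanceAs (NormedSpace ℝ (Hor n × Ver))
instance : MeasureSpace (QHeis n) := inferInstanceAs (MeasureSpace (Hor n × Ver))
instance : BorelSpace (QHeis n) := inferInstanceAs (BorelSpace (Hor n × Ver))

/-- The point with exponential coordinates `(a, s)`. -/
def mk (a : Hor n) (s : Ver) : QHeis n := (a, s)

/-- The projection `π : G → ℝ^{4n}` of the central extension. -/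
def hor (g : QHeis n) : Hor n := g.1

/-- The central coordinate. -/
def ver (g : QHeis n) : Ver := g.2

/-- The group law given by the Baker-Campbell-Hausdorff formula:
`(a, s) (b, t) = (a + b, s + t + ρ(a, b) / 2)`. -/
instance : Group (QHeis n) where
  mul g h := mk (hor g + hor h) (ver g + ver h + (1 / 2 : ℝ) • rho (hor g) (hor h))
  one := mk 0 0
  inv g := mk (-hor g) (-ver g)
  mul_assoc g h k := by
    refine Prod.ext (add_assoc (hor g) (hor h) (hor k)) ?_
    change (ver g + ver h + (1 / 2 : ℝ) • rho (hor g) (hor h)) + ver k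
        + (1 / 2 : ℝ) • rho (hor g + hor h) (hor k)
      = ver g + (ver h + ver k + (1 / 2 : ℝ) • rho (hor h) (hor k))
        + (1 / 2 : ℝ) • rho (hor g) (hor h + hor k)
    rw [rho_add_left, rho_add_right, smul_add, smul_add]
    abel
  one_mul g := by
    refine Prod.ext (zero_add (hor g)) ?_
    change 0 + ver g + (1 / 2 : ℝ) • rho 0 (hor g) = ver g
    rw [rho_zero_left, smul_zero, add_zero, zero_add]
  mul_one g := by
    refine Prod.ext (add_zero (hor g)) ?_
    change ver g + 0 + (1 / 2 : ℝ) • rho (hor g) 0 = ver g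
    rw [rho_zero_right, smul_zero, add_zero, add_zero]
  inv_mul_cancel g := by
    refine Prod.ext (neg_add_cancel (hor g)) ?_
    change -ver g + ver g + (1 / 2 : ℝ) • rho (-hor g) (hor g) = 0
    rw [rho_neg_self, smul_zero, add_zero, neg_add_cancel]

/-- The dilations `δ_r (a, s) = (r a, r² s)`. -/
def dil (r : ℝ) (g : QHeis n) : QHeis n := mk (r • hor g) (r ^ 2 • ver g)

/-- The left-invariant horizontal vector field in the direction `w ∈ ℝ^{4n}`, whose value at
`g = (a, s)` is the velocity `(w, ρ(a, w) / 2)` at `t = 0` of the curve `t ↦ g (t w, 0)`. -/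
def leftField (w : Hor n) (g : QHeis n) : QHeis n := mk w ((1 / 2 : ℝ) • rho (hor g) w)

section Weak

variable {M W : Type*} [NormedAddCommGroup M] [NormedSpace ℝ M] [MeasureSpace M]
  [NormedAddCommGroup W] [NormedSpace ℝ W]

/-- `u` is locally `p`-integrable. -/
def MemLpLoc (p : ℝ≥0∞) (u : M → W) : Prop :=
  ∀ K : Set M, IsCompact K → MemLp u p (volume.restrict K)

/-- `v` is the weak (distributional) derivative of `u` along the vector field `X`:
`∫ (X φ) u = - ∫ φ v` for all test functions `φ ∈ C_c^∞`. This is the right notion for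
divergence-free fields; it is used only for constant fields and for left-invariant fields. -/
def HasWeakDerivAlong (X : M → M) (u v : M → W) : Prop :=
  ∀ φ : M → ℝ, ContDiff ℝ ∞ φ → HasCompactSupport φ →
    ∫ x, (fderiv ℝ φ x (X x)) • u x = -∫ x, φ x • v x

end Weak

/-- `f ∈ W^{1,p}_loc(ℝ^{4n}; ℝ^{4n})`. -/
def IsSobolev (p : ℝ≥0∞) (f : Hor n → Hor n) : Prop :=
  MemLpLoc p f ∧
    ∀ w : Hor n, ∃ v : Hor n → Hor n, MemLpLoc p v ∧ HasWeakDerivAlong (fun _ => w) f v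

/-- `F` is a contact map of class `W^{1,p}_loc` of the quaternionic Heisenberg group: the
coordinates of `F` are locally `p`-integrable together with their weak derivatives along the
left-invariant horizontal fields, and for each such field the weak derivative `(a, b)` of `F` is
almost everywhere a horizontal vector at `F g`, that is, `b = ρ(hor (F g), a) / 2`. -/
def IsSobolevContact (p : ℝ≥0∞) (F : QHeis n → QHeis n) : Prop :=
  MemLpLoc p (fun g => hor (F g)) ∧ MemLpLoc p (fun g => ver (F g)) ∧
    ∀ w : Hor n, ∃ (a : QHeis n → Hor n) (b : QHeis n → Ver),
      MemLpLoc p a ∧ MemLpLoc p b ∧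
      HasWeakDerivAlong (leftField w) (fun g => hor (F g)) a ∧
      HasWeakDerivAlong (leftField w) (fun g => ver (F g)) b ∧
      ∀ᵐ g : QHeis n, mk (a g) (b g) = leftField (a g) (F g)

/-- `F` is a lift of `f`: `π ∘ F = f ∘ π`. -/
def IsLift (F : QHeis n → QHeis n) (f : Hor n → Hor n) : Prop :=
  ∀ g, hor (F g) = f (hor g)

/-- `F` is Pansu differentiable at `g` with Pansu differential `L`: `L` is a group homomorphism
that commutes with dilations, and `δ_{1/r} (F(g)⁻¹ F(g δ_r h))` tends to `L h` as `r → 0+`,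
uniformly for `h` in compact sets. -/
def HasPansuDerivAt (F : QHeis n → QHeis n) (L : QHeis n →* QHeis n) (g : QHeis n) : Prop :=
  (∀ r : ℝ, 0 < r → ∀ h, L (dil r h) = dil r (L h)) ∧
    ∀ K : Set (QHeis n), IsCompact K →
      TendstoUniformlyOn (fun (r : ℝ) (h : QHeis n) => dil r⁻¹ ((F g)⁻¹ * F (g * dil r h)))
        (fun h => L h) (𝓝[>] 0) K

end QuatHeis

end

open MeasureTheory Filter Topology
open scoped ENNReal ContDiff

noncomputable section

namespace QuatHeis

set_option linter.unusedSectionVars false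

/-! ### Weak derivatives and mollification -/

section WeakCalculus

open Convolution ContinuousLinearMap

variable {E W : Type*} [NormedAddCommGroup E] [NormedSpace ℝ E] [MeasureSpace E] [BorelSpace E]
  [FiniteDimensional ℝ E] [(volume : Measure E).IsAddHaarMeasure]
  [NormedAddCommGroup W] [NormedSpace ℝ W]

/-! Contactness makes the central action of the Pansu differential constant. The weak derivative of
the central coordinate along `leftField w` is `ρ(hor F, a) / 2`, where `hor F = f ∘ π` and its
derivative `a` are invariant under central translation. Central increments of `F` thus have
vanishing horizontal derivatives and, as brackets generate the centre, are constant
(`IsSobolevContact.exists_vertical_increment`). Blowing up, almost all Pansu differentials induce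
the same `φ` on the centre, so `ρ(Df v, Df w) = φ(ρ(v, w))` almost everywhere (`exists_scaling`).

Fix one such derivative `A₀`. Then `A₀⁻¹ Df(x)` preserves `ρ`, hence commutes with the anticommuting
`quatK` and `quatK'`: `Df(x)` intertwines them with fixed conjugates `P`, `P'`. This condition is
linear in `Df`, so it survives mollification. For a smooth map, symmetry of the second derivative
gives `P P' = P' P` on its values, which anticommutation forces to vanish. The mollifications are
affine, and so is their limit `f` (`exists_eq_add_of_intertwining`). Weak and Pansu derivatives are
matched by `HasWeakDerivAlong.ae_eq_lineDeriv`. -/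

theorem MemLpLoc.locallyIntegrable {p : ℝ≥0∞} (hp : 1 ≤ p) {u : E → W} (hu : MemLpLoc p u) :
    LocallyIntegrable u := by
  have : ProperSpace E := FiniteDimensional.proper ℝ E
  rw [locallyIntegrable_iff]
  intro K hK
  have : IsFiniteMeasure ((volume : Measure E).restrict K) :=
    ⟨by simpa using hK.measure_lt_top⟩
  exact (hu K hK).integrable hp

variable [CompleteSpace W]

theorem HasWeakDerivAlong.ae_eq {X : E → E} {u v v' : E → W} (hv : LocallyIntegrable v)
    (hv' : LocallyIntegrable v') (h : HasWeakDerivAlong X u v) (h' : HasWeakDerivAlong X u v') :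
    v =ᵐ[volume] v' := by
  refine ae_eq_of_integral_contDiff_smul_eq hv hv' fun φ hφ hc => ?_
  have := (h φ hφ hc).symm.trans (h' φ hφ hc)
  simpa using this

/-- The derivative of a mollification is the mollification of the weak derivative. -/
theorem HasWeakDerivAlong.fderiv_convolution {u v : E → W} {w : E} {η : E → ℝ}
    (hη : ContDiff ℝ ∞ η) (hc : HasCompactSupport η) (hu : LocallyIntegrable u)
    (h : HasWeakDerivAlong (fun _ => w) u v) (x : E) :
    fderiv ℝ (η ⋆[lsmul ℝ ℝ, volume] u) x w = (η ⋆[lsmul ℝ ℝ, volume] v) x := by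
  have h1 := hc.hasFDerivAt_convolution_left (lsmul ℝ ℝ : ℝ →L[ℝ] W →L[ℝ] W)
    (hη.of_le (by exact_mod_cast le_top)) hu x
  rw [h1.fderiv]
  have hex := (hc.fderiv (𝕜 := ℝ)).convolutionExists_left
    ((lsmul ℝ ℝ : ℝ →L[ℝ] W →L[ℝ] W).precompL E) (hη.continuous_fderiv (by simp)) hu x
  rw [convolution, ContinuousLinearMap.integral_apply hex]
  simp only [precompL_apply, lsmul_apply]
  -- Substituting `t ↦ x - t` moves the derivative onto the test function `y ↦ η (x - y)`.
  rw [← integral_sub_left_eq_self (fun t => (fderiv ℝ η t) w • u (x - t)) volume x,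
    convolution_eq_swap]
  simp only [sub_sub_cancel, lsmul_apply]
  have hψ : ContDiff ℝ ∞ (fun y => η (x - y)) := hη.comp (contDiff_const.sub contDiff_id)
  have hψc : HasCompactSupport (fun y => η (x - y)) :=
    hc.comp_homeomorph (Homeomorph.subLeft x)
  have := h _ hψ hψc
  have hd : ∀ y, fderiv ℝ (fun y => η (x - y)) y w = -(fderiv ℝ η (x - y) w) := by
    intro y
    have h1 : HasFDerivAt η (fderiv ℝ η (x - y)) (x - y) :=
      (hη.differentiable (by simp) _).hasFDerivAt
    have h2 : HasFDerivAt (fun y => x - y) (-ContinuousLinearMap.id ℝ E) y := by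
      simpa using (hasFDerivAt_id y).const_sub x
    have h3 := (h1.comp y h2).fderiv
    have h4 : fderiv ℝ (fun y => η (x - y)) y = _ := h3
    rw [h4]; simp
  simp only [hd, neg_smul, integral_neg, neg_inj] at this
  exact this

/-- A sequence of bump functions shrinking to the origin. -/
def bump (E : Type*) [NormedAddCommGroup E] (k : ℕ) : ContDiffBump (0 : E) where
  rIn := 1 / ((k : ℝ) + 1)
  rOut := 2 * (1 / ((k : ℝ) + 1))
  rIn_pos := Nat.one_div_pos_of_nat
  rIn_lt_rOut := by have : 0 < 1 / ((k : ℝ) + 1) := Nat.one_div_pos_of_nat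
                    linarith

theorem tendsto_bump_rOut : Tendsto (fun k => (bump E k).rOut) atTop (𝓝 0) := by
  simpa [bump] using (tendsto_one_div_add_atTop_nhds_zero_nat (𝕜 := ℝ)).const_mul 2

/-- The mollification of `u` by the `k`-th bump function. -/
def mollify (k : ℕ) (u : E → W) : E → W := (bump E k).normed volume ⋆[lsmul ℝ ℝ, volume] u

theorem contDiff_mollify (k : ℕ) {u : E → W} (hu : LocallyIntegrable u) :
    ContDiff ℝ ∞ (mollify k u) :=
  (bump E k).hasCompactSupport_normed.contDiff_convolution_left _ (bump E k).contDiff_normed hu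

theorem fderiv_mollify (k : ℕ) {u v : E → W} {w : E} (hu : LocallyIntegrable u)
    (h : HasWeakDerivAlong (fun _ => w) u v) (x : E) :
    fderiv ℝ (mollify k u) x w = mollify k v x :=
  h.fderiv_convolution (bump E k).contDiff_normed (bump E k).hasCompactSupport_normed hu x

theorem ae_tendsto_mollify {u : E → W} (hu : LocallyIntegrable u) :
    ∀ᵐ x, Tendsto (fun k => mollify k u x) atTop (𝓝 (u x)) :=
  ContDiffBump.ae_convolution_tendsto_right_of_locallyIntegrable (K := 2) tendsto_bump_rOut
    (Eventually.of_forall fun _ => le_rfl) hu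

theorem tendsto_mollify {u : E → W} (hu : Continuous u) (x : E) :
    Tendsto (fun k => mollify k u x) atTop (𝓝 (u x)) :=
  ContDiffBump.convolution_tendsto_right_of_continuous tendsto_bump_rOut hu x

theorem ae_eq_const_of_hasWeakDerivAlong_zero {u : E → W} (hu : LocallyIntegrable u)
    (h : ∀ w : E, HasWeakDerivAlong (fun _ => w) u (fun _ => 0)) :
    ∃ c, u =ᵐ[volume] fun _ => c := by
  have hconst : ∀ k x, mollify k u x = mollify k u 0 := by
    intro k x
    refine is_const_of_fderiv_eq_zero (𝕜 := ℝ) ((contDiff_mollify k hu).differentiable (by simp))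
      (fun y => ?_) x 0
    ext w
    rw [fderiv_mollify k hu (h w) y]
    simp [mollify, convolution]
  obtain ⟨x₀, hx₀⟩ := (ae_tendsto_mollify hu).exists
  refine ⟨u x₀, ?_⟩
  filter_upwards [ae_tendsto_mollify hu] with x hx
  simp only [hconst _ x] at hx
  simp only [hconst _ x₀] at hx₀
  exact tendsto_nhds_unique hx hx₀

/-- Weak derivatives along a field that is invariant under translation by `c` are translated with
the function. -/
theorem HasWeakDerivAlong.comp_add_right {X : E → E} {u v : E → W}
    (h : HasWeakDerivAlong X u v) {c : E} (hX : ∀ x, X (x + c) = X x) :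
    HasWeakDerivAlong X (fun x => u (x + c)) (fun x => v (x + c)) := by
  intro φ hφ hc
  have h1 := h (fun x => φ (x - c)) (hφ.comp (contDiff_id.sub contDiff_const))
    (hc.comp_homeomorph (Homeomorph.subRight c))
  rw [← integral_add_right_eq_self _ c,
    ← integral_add_right_eq_self (fun x => φ (x - c) • v x) c] at h1
  simp only [add_sub_cancel_right, fderiv_comp_sub, hX] at h1
  exact h1

/-- Local integrability lets each integral be split; without it the Bochner integral could default
to zero. -/
theorem HasWeakDerivAlong.sub {X : E → E} (hX : Continuous X) {u v u' v' : E → W}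
    (hu : LocallyIntegrable u) (hv : LocallyIntegrable v) (hu' : LocallyIntegrable u')
    (hv' : LocallyIntegrable v') (h : HasWeakDerivAlong X u v) (h' : HasWeakDerivAlong X u' v') :
    HasWeakDerivAlong X (fun x => u x - u' x) (fun x => v x - v' x) := by
  intro φ hφ hc
  have hcont : Continuous fun x => fderiv ℝ φ x (X x) :=
    (hφ.continuous_fderiv (by simp)).clm_apply hX
  have hcs : HasCompactSupport fun x => fderiv ℝ φ x (X x) :=
    (hc.fderiv (𝕜 := ℝ)).mono fun x hx h0 => hx (by simp [h0])
  simp only [smul_sub]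
  rw [integral_sub (hu.integrable_smul_left_of_hasCompactSupport hcont hcs)
      (hu'.integrable_smul_left_of_hasCompactSupport hcont hcs),
    integral_sub (hv.integrable_smul_left_of_hasCompactSupport hφ.continuous hc)
      (hv'.integrable_smul_left_of_hasCompactSupport hφ.continuous hc), h φ hφ hc, h' φ hφ hc]
  abel

theorem HasWeakDerivAlong.congr_ae {X : E → E} {u v v' : E → W} (h : HasWeakDerivAlong X u v)
    (hv : v =ᵐ[volume] v') : HasWeakDerivAlong X u v' := by
  intro φ hφ hc
  rw [h φ hφ hc]
  congr 1
  exact integral_congr_ae (hv.mono fun x hx => by simp only [hx])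

end WeakCalculus

/-! ### Weak directional derivatives as classical ones -/

section LineDerivative

open Convolution ContinuousLinearMap Set

variable {E W : Type*} [NormedAddCommGroup E] [NormedSpace ℝ E] [MeasureSpace E] [BorelSpace E]
  [FiniteDimensional ℝ E] [(volume : Measure E).IsAddHaarMeasure]
  [NormedAddCommGroup W] [NormedSpace ℝ W]

/-- The shear transfers almost-everywhere statements on `E` to almost every line in direction `w`,
through Fubini. -/
theorem measurePreserving_shear (w : E) :
    MeasurePreserving (fun q : ℝ × E => (q.1, q.2 + q.1 • w))
      ((volume : Measure ℝ).prod (volume : Measure E))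
      ((volume : Measure ℝ).prod (volume : Measure E)) := by
  have : ProperSpace E := FiniteDimensional.proper ℝ E
  refine (MeasurePreserving.id (volume : Measure ℝ)).skew_product
    (g := fun s z => z + s • w) ?_ (Eventually.of_forall fun s => map_add_right_eq_self _ _)
  have : Continuous (Function.uncurry fun (s : ℝ) (z : E) => z + s • w) := by
    unfold Function.uncurry; fun_prop
  exact this.measurable

theorem ae_shear {P : E → Prop} (h : ∀ᵐ x, P x) (w : E) :
    ∀ᵐ q ∂((volume : Measure ℝ).prod (volume : Measure E)), P (q.2 + q.1 • w) := by
  have h1 : ∀ᵐ q ∂((volume : Measure ℝ).prod (volume : Measure E)), P q.2 :=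
    Measure.quasiMeasurePreserving_snd.ae h
  exact (measurePreserving_shear w).quasiMeasurePreserving.ae h1

theorem integrableOn_shear {v : E → W} (hv : LocallyIntegrable v) (w : E) {K : Set E}
    (hK : IsCompact K) (a b : ℝ) :
    IntegrableOn (fun q : ℝ × E => v (q.2 + q.1 • w)) (Icc a b ×ˢ K)
      ((volume : Measure ℝ).prod (volume : Measure E)) := by
  have : ProperSpace E := FiniteDimensional.proper ℝ E
  set K' : Set E := (fun q : ℝ × E => q.2 + q.1 • w) '' (Icc a b ×ˢ K)
  have hK' : IsCompact K' := (isCompact_Icc.prod hK).image (by fun_prop)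
  have h1 : IntegrableOn (fun q : ℝ × E => v q.2) (Icc a b ×ˢ K')
      ((volume : Measure ℝ).prod (volume : Measure E)) := by
    rw [IntegrableOn, ← Measure.prod_restrict]
    exact (hv.integrableOn_isCompact hK').comp_snd _
  have h2 := (measurePreserving_shear w).restrict_preimage
    (measurableSet_Icc.prod hK'.measurableSet : MeasurableSet (Icc a b ×ˢ K'))
  have h3 := h2.integrable_comp_of_integrable h1
  refine IntegrableOn.mono_set (t := (fun q : ℝ × E => (q.1, q.2 + q.1 • w)) ⁻¹' (Icc a b ×ˢ K'))
    h3 ?_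
  rintro ⟨s, z⟩ ⟨hs, hz⟩
  exact ⟨hs, (s, z), ⟨hs, hz⟩, rfl⟩

theorem ae_locallyIntegrable_line {v : E → W} (hv : LocallyIntegrable v) (w : E) :
    ∀ᵐ x, LocallyIntegrable (fun s : ℝ => v (x + s • w)) := by
  have : ProperSpace E := FiniteDimensional.proper ℝ E
  have h : ∀ k : ℕ, ∀ᵐ x, x ∈ Metric.closedBall (0 : E) k →
      IntegrableOn (fun s : ℝ => v (x + s • w)) (Icc (-k : ℝ) k) := by
    intro k
    have h1 := integrableOn_shear hv w (isCompact_closedBall (0 : E) k) (-k) k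
    rw [IntegrableOn, ← Measure.prod_restrict] at h1
    have h2 := h1.prod_left_ae
    rwa [ae_restrict_iff' measurableSet_closedBall] at h2
  filter_upwards [ae_all_iff.2 h] with x hx
  rw [locallyIntegrable_iff]
  intro K hK
  obtain ⟨r, hr⟩ := hK.isBounded.subset_closedBall 0
  obtain ⟨k, hk⟩ := exists_nat_ge (max r ‖x‖)
  refine (hx k ?_).mono_set (hr.trans ?_)
  · simpa using (le_max_right _ _).trans hk
  · rw [Real.closedBall_eq_Icc]
    have := (le_max_left _ _).trans hk
    exact Icc_subset_Icc (by linarith) (by linarith)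

variable [CompleteSpace W]

/-- Tested against `φ`, this is the fundamental theorem of calculus for `s ↦ ∫ φ(z) f(z + s w) dz`,
followed by Fubini. -/
theorem HasWeakDerivAlong.ae_sub_eq_integral_of_nonneg {f v : E → W} (hf : Continuous f)
    (hv : LocallyIntegrable v)
    {w : E} (h : HasWeakDerivAlong (fun _ => w) f v) {t : ℝ} (ht : 0 ≤ t) :
    ∀ᵐ x, f (x + t • w) - f x = ∫ s in (0 : ℝ)..t, v (x + s • w) := by
  have : ProperSpace E := FiniteDimensional.proper ℝ E
  have hprod : ∀ K : Set E, IsCompact K → Integrable (fun q : ℝ × E => v (q.2 + q.1 • w))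
      (((volume : Measure ℝ).restrict (Ioc 0 t)).prod ((volume : Measure E).restrict K)) := by
    intro K hK
    rw [Measure.prod_restrict]
    exact (integrableOn_shear hv w hK 0 t).mono_set (prod_mono Ioc_subset_Icc_self subset_rfl)
  simp only [intervalIntegral.integral_of_le ht]
  refine ae_eq_of_integral_contDiff_smul_eq ?_ ?_ fun φ hφ hc => ?_
  · exact ((hf.comp (by fun_prop)).sub hf).locallyIntegrable
  · rw [locallyIntegrable_iff]
    intro K hK
    exact (hprod K hK).integral_prod_right
  -- The reflection makes convolution with `η` at `y` equal to `∫ φ(z) u(z + y) dz`.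
  set η : E → ℝ := fun y => φ (-y) with hη_def
  have hη : ContDiff ℝ ∞ η := hφ.comp contDiff_neg
  have hηc : HasCompactSupport η := hc.comp_homeomorph (Homeomorph.neg E)
  have hconv : ∀ (u : E → W) (y : E), (η ⋆[lsmul ℝ ℝ, volume] u) y = ∫ z, φ z • u (z + y) := by
    intro u y
    rw [convolution, ← integral_neg_eq_self]
    simp [hη_def, add_comm]
  have hder : ∀ s : ℝ, HasDerivAt (fun s : ℝ => (η ⋆[lsmul ℝ ℝ, volume] f) (s • w))
      ((η ⋆[lsmul ℝ ℝ, volume] v) (s • w)) s := by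
    intro s
    rw [← h.fderiv_convolution hη hηc hf.locallyIntegrable]
    have h1 : DifferentiableAt ℝ (η ⋆[lsmul ℝ ℝ, volume] f) (s • w) :=
      ((hηc.contDiff_convolution_left (lsmul ℝ ℝ : ℝ →L[ℝ] W →L[ℝ] W) hη
        hf.locallyIntegrable).differentiable (by simp)) _
    have h2 : HasDerivAt (fun s : ℝ => s • w) w s := by
      simpa using (hasDerivAt_id s).smul_const w
    exact h1.hasFDerivAt.comp_hasDerivAt s h2
  have hcont : Continuous fun s : ℝ => (η ⋆[lsmul ℝ ℝ, volume] v) (s • w) :=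
    (hηc.contDiff_convolution_left (lsmul ℝ ℝ : ℝ →L[ℝ] W →L[ℝ] W) hη hv).continuous.comp
      (by fun_prop)
  have hftc := intervalIntegral.integral_eq_sub_of_hasDerivAt (fun s _ => hder s)
    (hcont.intervalIntegrable 0 t)
  simp only [hconv, zero_smul, add_zero, intervalIntegral.integral_of_le ht] at hftc
  have hint : ∀ u : E → W, LocallyIntegrable u → Integrable (fun z => φ z • u z) := fun u hu =>
    hu.integrable_smul_left_of_hasCompactSupport hφ.continuous hc
  simp only [smul_sub]
  rw [integral_sub (hint (fun x => f (x + t • w)) (hf.comp (by fun_prop)).locallyIntegrable)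
    (hint f hf.locallyIntegrable), ← hftc]
  have hK : IsCompact (tsupport φ) := hc
  have hset : ∀ u : E → W, ∫ z, φ z • u z = ∫ z in tsupport φ, φ z • u z := by
    intro u
    refine (setIntegral_eq_integral_of_forall_compl_eq_zero fun z hz => ?_).symm
    rw [image_eq_zero_of_notMem_tsupport hz, zero_smul]
  rw [hset]
  have hs : ∀ s : ℝ, ∫ z, φ z • v (z + s • w) = ∫ z in tsupport φ, φ z • v (z + s • w) :=
    fun s => hset fun z => v (z + s • w)
  simp only [hs, ← integral_smul]
  refine integral_integral_swap ?_
  obtain ⟨C, hC⟩ := hφ.continuous.bounded_above_of_compact_support hc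
  refine (hprod _ hK).bdd_smul (C := C) ?_ ?_
  · exact (hφ.continuous.comp continuous_snd).aestronglyMeasurable
  · exact Eventually.of_forall fun q => hC q.2

theorem HasWeakDerivAlong.ae_sub_eq_integral {f v : E → W} (hf : Continuous f)
    (hv : LocallyIntegrable v)
    {w : E} (h : HasWeakDerivAlong (fun _ => w) f v) (t : ℝ) :
    ∀ᵐ x, f (x + t • w) - f x = ∫ s in (0 : ℝ)..t, v (x + s • w) := by
  rcases le_total 0 t with ht | ht
  · exact h.ae_sub_eq_integral_of_nonneg hf hv ht
  have h1 := h.ae_sub_eq_integral_of_nonneg hf hv (neg_nonneg.2 ht)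
  have h2 := (measurePreserving_add_right (volume : Measure E) (t • w)).quasiMeasurePreserving.ae h1
  filter_upwards [h2] with x hx
  have h3 : ∀ s : ℝ, x + t • w + s • w = x + (s + t) • w := fun s => by rw [add_smul]; abel
  simp only [h3, intervalIntegral.integral_comp_add_right (fun s => v (x + s • w)) t] at hx
  rw [neg_add_cancel, zero_smul, add_zero, zero_add, intervalIntegral.integral_symm] at hx
  rw [← neg_sub, hx, neg_neg]

/-- A weak directional derivative of a continuous function is almost everywhere its classical
directional derivative. -/
theorem HasWeakDerivAlong.ae_eq_lineDeriv {f v : E → W} (hf : Continuous f)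
    (hv : LocallyIntegrable v) {w : E} (h : HasWeakDerivAlong (fun _ => w) f v) :
    ∀ᵐ x, v x = lineDeriv ℝ f x w := by
  have : ProperSpace E := FiniteDimensional.proper ℝ E
  -- The exceptional null set depends on the increment; rational increments share one, and
  -- continuity recovers the others.
  have hrat : ∀ᵐ x, ∀ r : ℚ, f (x + (r : ℝ) • w) - f x = ∫ s in (0 : ℝ)..r, v (x + s • w) :=
    ae_all_iff.2 fun r => h.ae_sub_eq_integral hf hv r
  have hline : ∀ᵐ x, ∀ᵐ t : ℝ, v (x + t • w) = lineDeriv ℝ f (x + t • w) w := by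
    filter_upwards [hrat, ae_locallyIntegrable_line hv w] with x hx hxi
    have hall : (fun t : ℝ => f (x + t • w) - f x) = fun t => ∫ s in (0 : ℝ)..t, v (x + s • w) := by
      refine Continuous.ext_on Rat.isDenseEmbedding_coe_real.dense ?_ ?_ ?_
      · exact (hf.comp (by fun_prop)).sub continuous_const
      · exact intervalIntegral.continuous_primitive
          (fun a b => (hxi.integrableOn_isCompact isCompact_uIcc).intervalIntegrable) 0
      · rintro _ ⟨r, rfl⟩
        exact hx r
    filter_upwards [LocallyIntegrable.ae_hasDerivAt_integral hxi] with t ht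
    have h1 := ht 0
    rw [← hall] at h1
    have h2 : HasDerivAt (fun t : ℝ => f (x + t • w)) (v (x + t • w)) t := by
      simpa using h1.add_const (f x)
    have h3 : HasLineDerivAt ℝ f (v (x + t • w)) (x + t • w) w := by
      have h4 : HasDerivAt (fun s : ℝ => f (x + (t + s) • w)) (v (x + t • w)) 0 :=
        HasDerivAt.comp_const_add t 0 (by simpa using h2)
      simpa [HasLineDerivAt, add_smul, add_assoc] using h4
    exact h3.lineDeriv.symm
  -- Exchanging the two almost-everywhere quantifiers needs a measurable set, hence a measurable
  -- representative of `v`. One good `t` then suffices, after translating back by `-(t • w)`.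
  have hmk := hv.aestronglyMeasurable.ae_eq_mk
  set v' := hv.aestronglyMeasurable.mk v
  have hmeas : MeasurableSet {x | v' x = lineDeriv ℝ f x w} :=
    hv.aestronglyMeasurable.stronglyMeasurable_mk.measurableSet_eq_fun
      (stronglyMeasurable_lineDeriv hf)
  have hswap := Measure.ae_ae_of_ae_prod (Measure.measurePreserving_swap.quasiMeasurePreserving.ae
    (ae_shear hmk w))
  have h1 : ∀ᵐ x : E, ∀ᵐ t : ℝ, v' (x + t • w) = lineDeriv ℝ f (x + t • w) w := by
    filter_upwards [hline, hswap] with x hx hx'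
    filter_upwards [hx, hx'] with t ht ht'
    rw [← ht]
    exact ht'.symm
  rw [Measure.ae_ae_comm] at h1
  · obtain ⟨t, ht⟩ := h1.exists
    have h2 := (measurePreserving_add_right (volume : Measure E)
      (-(t • w))).quasiMeasurePreserving.ae ht
    filter_upwards [h2, hmk] with x hx hx'
    rw [hx']
    simpa using hx
  · exact hmeas.preimage (f := fun q : E × ℝ => q.1 + q.2 • w)
      (by fun_prop : Continuous fun q : E × ℝ => q.1 + q.2 • w).measurable

end LineDerivative

/-! ### Intertwined derivatives force affinity -/

section Rigidity

open Convolution ContinuousLinearMap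

variable {E W : Type*} [NormedAddCommGroup E] [NormedSpace ℝ E] [MeasureSpace E] [BorelSpace E]
  [FiniteDimensional ℝ E] [(volume : Measure E).IsAddHaarMeasure]
  [NormedAddCommGroup W] [NormedSpace ℝ W] [CompleteSpace W]

theorem mollify_congr_ae (k : ℕ) {u v : E → W} (h : u =ᵐ[volume] v) : mollify k u = mollify k v := by
  ext x
  rw [mollify, convolution_eq_swap, mollify, convolution_eq_swap]
  exact integral_congr_ae (h.mono fun y hy => by simp only [hy])

theorem mollify_clm_comp (k : ℕ) {u : E → W} (hu : LocallyIntegrable u) (P : W →L[ℝ] W) (x : E) :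
    mollify k (fun y => P (u y)) x = P (mollify k u x) := by
  have hex := ((bump E k).hasCompactSupport_normed (μ := volume)).convolutionExists_left
    (lsmul ℝ ℝ : ℝ →L[ℝ] W →L[ℝ] W) (bump E k).continuous_normed hu x
  rw [mollify, mollify, convolution, convolution, ← P.integral_comp_comm hex]
  simp

/-- A `C²` map whose derivative intertwines two maps of the source with two linear maps of the
target that commute nowhere has vanishing second derivative. -/
theorem fderiv_eq_of_intertwining {g : E → W} (hg : ContDiff ℝ ∞ g) {K K' : E → E}
    {P P' : W →L[ℝ] W} (hP : ∀ y, P (P' y) = P' (P y) → y = 0)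
    (hK : ∀ x w, fderiv ℝ g x (K w) = P (fderiv ℝ g x w))
    (hK' : ∀ x w, fderiv ℝ g x (K' w) = P' (fderiv ℝ g x w)) (x : E) :
    fderiv ℝ g x = fderiv ℝ g 0 := by
  have hd : Differentiable ℝ (fderiv ℝ g) :=
    (hg.fderiv_right (m := ∞) (by simp)).differentiable (by simp)
  refine is_const_of_fderiv_eq_zero (𝕜 := ℝ) hd (fun y => ?_) x 0
  set D := fderiv ℝ (fderiv ℝ g) y
  have hD : HasFDerivAt (fderiv ℝ g) D y := (hd y).hasFDerivAt
  have hsymm : ∀ u w, D u w = D w u := fun u w =>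
    second_derivative_symmetric (fun z => (hg.differentiable (by simp) z).hasFDerivAt) hD u w
  have hap : ∀ w, HasFDerivAt (fun z => fderiv ℝ g z w)
      ((ContinuousLinearMap.apply ℝ W w).comp D) y := fun w =>
    (ContinuousLinearMap.apply ℝ W w).hasFDerivAt.comp y hD
  have key : ∀ {L : E → E} {Q : W →L[ℝ] W},
      (∀ x w, fderiv ℝ g x (L w) = Q (fderiv ℝ g x w)) → ∀ u w, D u (L w) = Q (D u w) := by
    intro L Q hL u w
    have h1 := hap (L w)
    simp only [hL] at h1
    have h2 := h1.unique (Q.hasFDerivAt.comp y (hap w))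
    simpa using congrArg (fun T => T u) h2
  ext u w
  refine hP _ ?_
  -- Both orders of `P` and `P'` compute `D (K u) (K' w)`, by symmetry of `D`.
  calc P (P' (D u w)) = P (D u (K' w)) := by rw [key hK']
    _ = D (K' w) (K u) := by rw [hsymm u, ← key hK]
    _ = P' (D (K u) w) := by rw [hsymm, key hK']
    _ = P' (P (D u w)) := by rw [hsymm, key hK, hsymm]

/-- The weak form of `fderiv_eq_of_intertwining`: such a map is affine. -/
theorem exists_eq_add_of_intertwining {f : E → W} (hf : Continuous f) {v : E → E → W}
    (hv : ∀ w, LocallyIntegrable (v w)) (hfv : ∀ w, HasWeakDerivAlong (fun _ => w) f (v w))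
    {K K' : E → E} {P P' : W →L[ℝ] W} (hP : ∀ y, P (P' y) = P' (P y) → y = 0)
    (hK : ∀ w, v (K w) =ᵐ[volume] fun x => P (v w x))
    (hK' : ∀ w, v (K' w) =ᵐ[volume] fun x => P' (v w x)) :
    ∃ T : E →L[ℝ] W, ∀ x, f x = T x + f 0 := by
  have : ProperSpace E := FiniteDimensional.proper ℝ E
  have hfl := hf.locallyIntegrable (μ := (volume : Measure E))
  have hmol : ∀ k x, mollify k f x = fderiv ℝ (mollify k f) 0 x + mollify k f 0 := by
    intro k x
    have hg := contDiff_mollify k hfl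
    have hc := fderiv_eq_of_intertwining hg (K := K) (K' := K') hP
      (fun x w => by
        rw [fderiv_mollify k hfl (hfv _), fderiv_mollify k hfl (hfv _), mollify_congr_ae k (hK w),
          mollify_clm_comp k (hv w)])
      (fun x w => by
        rw [fderiv_mollify k hfl (hfv _), fderiv_mollify k hfl (hfv _), mollify_congr_ae k (hK' w),
          mollify_clm_comp k (hv w)])
    have hdiff : Differentiable ℝ fun y => mollify k f y - fderiv ℝ (mollify k f) 0 y :=
      (hg.differentiable (by simp)).sub (fderiv ℝ (mollify k f) 0).differentiable
    have := is_const_of_fderiv_eq_zero (𝕜 := ℝ) hdiff (fun y => by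
      rw [fderiv_fun_sub (hg.differentiable (by simp) y)
        (fderiv ℝ (mollify k f) 0).differentiableAt, hc y, ContinuousLinearMap.fderiv, sub_self]) x 0
    simp only [map_zero, sub_zero] at this
    rw [← this]; abel
  have hlim := tendsto_mollify hf
  -- Additivity passes to pointwise limits, so no convergence of the linear parts is needed.
  have hadd : ∀ x y, f (x + y) - f 0 = (f x - f 0) + (f y - f 0) := by
    intro x y
    refine tendsto_nhds_unique ((hlim (x + y)).sub (hlim 0))
      ((((hlim x).sub (hlim 0)).add ((hlim y).sub (hlim 0))).congr fun k => ?_)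
    rw [hmol k (x + y), hmol k x, hmol k y, map_add]
    abel
  let T₀ : E →+ W :=
    { toFun := fun x => f x - f 0
      map_zero' := sub_self _
      map_add' := hadd }
  refine ⟨T₀.toRealLinearMap (hf.sub continuous_const), fun x => ?_⟩
  simp [T₀]

end Rigidity

/-! ### The form `ρ`, its quaternionic endomorphisms and graded automorphisms -/

section Algebra

variable {n : ℕ}

theorem rho_smul_left (r : ℝ) (a b : Hor n) : rho (r • a) b = r • rho a b := by
  ext k
  fin_cases k <;> simp [rho, Finset.mul_sum] <;>
    exact Finset.sum_congr rfl fun i _ => by ring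

theorem rho_swap (a b : Hor n) : rho b a = -rho a b := by
  ext k
  fin_cases k <;> simp [rho, ← Finset.sum_neg_distrib] <;>
    exact Finset.sum_congr rfl fun i _ => by ring

theorem rho_self (a : Hor n) : rho a a = 0 := by
  ext k
  fin_cases k <;> simp [rho] <;>
    exact Finset.sum_eq_zero fun i _ => by ring

theorem exists_rho_eq (hn : 0 < n) (c : Ver) : ∃ v w : Hor n, rho v w = c := by
  -- In one quaternionic coordinate, take `v = 1` and `w` the imaginary quaternion with components
  -- `c`.
  refine ⟨WithLp.toLp 2 fun q => if q.1 = ⟨0, hn⟩ then ![1, 0, 0, 0] q.2 else 0,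
    WithLp.toLp 2 fun q => if q.1 = ⟨0, hn⟩ then ![0, c 0, c 1, c 2] q.2 else 0, ?_⟩
  ext k
  fin_cases k <;> simp [rho]

/-- The endomorphism with `ρ₁ (quatK a, b) = ρ₂ (a, b)`. -/
def quatK : Hor n →ₗ[ℝ] Hor n where
  toFun a := WithLp.toLp 2 fun q => ![a (q.1, 3), a (q.1, 2), -a (q.1, 1), -a (q.1, 0)] q.2
  map_add' a b := by
    ext ⟨i, k⟩
    fin_cases k <;> simp <;> ring
  map_smul' r a := by
    ext ⟨i, k⟩
    fin_cases k <;> simp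

/-- The endomorphism with `ρ₁ (quatK' a, b) = ρ₃ (a, b)`. -/
def quatK' : Hor n →ₗ[ℝ] Hor n where
  toFun a := WithLp.toLp 2 fun q => ![-a (q.1, 2), a (q.1, 3), a (q.1, 0), -a (q.1, 1)] q.2
  map_add' a b := by
    ext ⟨i, k⟩
    fin_cases k <;> simp <;> ring
  map_smul' r a := by
    ext ⟨i, k⟩
    fin_cases k <;> simp

theorem rho_quatK (a b : Hor n) : rho (quatK a) b 0 = rho a b 1 := by
  simp only [rho, quatK, LinearMap.coe_mk, AddHom.coe_mk, PiLp.toLp_apply, Matrix.cons_val]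
  exact Finset.sum_congr rfl fun i _ => by ring

theorem rho_quatK' (a b : Hor n) : rho (quatK' a) b 0 = rho a b 2 := by
  simp only [rho, quatK', LinearMap.coe_mk, AddHom.coe_mk, PiLp.toLp_apply, Matrix.cons_val]
  exact Finset.sum_congr rfl fun i _ => by ring

/-- The two endomorphisms anticommute and their product is invertible. -/
theorem eq_zero_of_quatK_comm {a : Hor n} (h : quatK (quatK' a) = quatK' (quatK a)) : a = 0 := by
  ext ⟨i, k⟩
  have h' := fun k => congrArg (fun b : Hor n => b (i, k)) h
  have h0 := h' 0
  have h1 := h' 1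
  have h2 := h' 2
  have h3 := h' 3
  simp only [quatK, quatK', LinearMap.coe_mk, AddHom.coe_mk, PiLp.toLp_apply,
    Matrix.cons_val] at h0 h1 h2 h3
  fin_cases k <;> simp <;> linarith

/-- Pairing `a` with `quatK (quatK' a)` under `ρ₁` gives `‖a‖²`. -/
theorem eq_zero_of_rho_zero {a : Hor n} (h : ∀ b, rho a b 0 = 0) : a = 0 := by
  have h1 := h (quatK (quatK' a))
  simp only [rho, quatK, quatK', LinearMap.coe_mk, AddHom.coe_mk, PiLp.toLp_apply,
    Matrix.cons_val] at h1
  rw [Finset.sum_eq_zero_iff_of_nonneg fun i _ => by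
    nlinarith [sq_nonneg (a (i, 0)), sq_nonneg (a (i, 1)), sq_nonneg (a (i, 2)),
      sq_nonneg (a (i, 3))]] at h1
  ext ⟨i, k⟩
  have h2 := h1 i (Finset.mem_univ i)
  refine pow_eq_zero_iff (two_ne_zero) |>.1 (le_antisymm ?_ (sq_nonneg _))
  fin_cases k <;> simp <;>
    nlinarith [sq_nonneg (a (i, 0)), sq_nonneg (a (i, 1)), sq_nonneg (a (i, 2)),
      sq_nonneg (a (i, 3))]

/-- A surjective endomorphism preserving `ρ` commutes with any endomorphism expressing a component
of `ρ` through `ρ₁`. -/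
theorem map_comm_of_rho_eq {B K : Hor n → Hor n} (hB : Function.Surjective B)
    (hρ : ∀ v w, rho (B v) (B w) = rho v w) {k : Fin 3} (hK : ∀ a b, rho (K a) b 0 = rho a b k)
    (v : Hor n) : B (K v) = K (B v) := by
  have h : B (K v) + (-1 : ℝ) • K (B v) = 0 := by
    -- Against `B w`, both `B (K v)` and `K (B v)` pair under `ρ₁` to component `k` of `ρ(v, w)`.
    refine eq_zero_of_rho_zero fun b => ?_
    obtain ⟨w, rfl⟩ := hB b
    rw [rho_add_left, rho_smul_left, PiLp.add_apply, PiLp.smul_apply, hρ, hK, hK, hρ]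
    simp
  rw [neg_one_smul] at h
  exact eq_of_sub_eq_zero (by rw [sub_eq_add_neg, h])

theorem mk_mul_mk (a b : Hor n) (s t : Ver) :
    mk a s * mk b t = mk (a + b) (s + t + (1 / 2 : ℝ) • rho a b) := rfl

theorem dil_mk (r : ℝ) (a : Hor n) (s : Ver) : dil r (mk a s) = mk (r • a) (r ^ 2 • s) := rfl

theorem mk_hor_ver (g : QHeis n) : mk (hor g) (ver g) = g := rfl

theorem mk_inj {a b : Hor n} {s t : Ver} (h : mk a s = mk b t) : a = b ∧ s = t :=
  ⟨congrArg hor h, congrArg ver h⟩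

/-- An additive self-map commuting with positive homotheties is linear. -/
def linearOfPosHomogeneous {V : Type*} [AddCommGroup V] [Module ℝ V] (α : V → V)
    (hadd : ∀ a b, α (a + b) = α a + α b) (hsmul : ∀ r : ℝ, 0 < r → ∀ a, α (r • a) = r • α a) :
    V →ₗ[ℝ] V where
  toFun := α
  map_add' := hadd
  map_smul' r a := by
    have h0 : α 0 = 0 := by simpa using hadd 0 0
    have hneg : ∀ b, α (-b) = -α b := fun b => by
      rw [← sub_eq_zero, sub_neg_eq_add, ← hadd, neg_add_cancel, h0]
    rcases lt_trichotomy r 0 with hr | rfl | hr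
    · have := hsmul (-r) (neg_pos.2 hr) a
      rw [neg_smul, hneg, neg_smul, neg_inj] at this
      simpa using this
    · simpa using h0
    · simpa using hsmul r hr a

/-- Bijective homomorphisms commuting with dilations are graded linear automorphisms. -/
theorem exists_graded_of_bijective (L : QHeis n →* QHeis n)
    (hL : ∀ r : ℝ, 0 < r → ∀ h, L (dil r h) = dil r (L h)) (hb : Function.Injective L) :
    ∃ (A : Hor n ≃L[ℝ] Hor n) (φ : Ver ≃L[ℝ] Ver), (∀ a, L (mk a 0) = mk (A a) 0) ∧
      (∀ s, L (mk 0 s) = mk 0 (φ s)) ∧ ∀ v w, rho (A v) (A w) = φ (rho v w) := by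
  have h1 : ∀ a, L (mk a 0) = mk (hor (L (mk a 0))) 0 := by
    intro a
    -- The square of `(a, 0)` is its dilation by 2, so the central part `t` of its image satisfies
    -- `2t = 4t`.
    have e : mk a (0 : Ver) * mk a 0 = dil 2 (mk a 0) := by
      rw [mk_mul_mk, dil_mk, rho_self, two_smul]; simp
    have e2 := congrArg L e
    rw [map_mul, hL 2 two_pos, ← mk_hor_ver (L (mk a 0)), mk_mul_mk, dil_mk, rho_self] at e2
    have e3 := (mk_inj e2).2
    rw [smul_zero, add_zero, ← two_smul ℝ, ← sub_eq_zero, ← sub_smul] at e3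
    have e4 : ver (L (mk a 0)) = 0 := (smul_eq_zero.1 e3).resolve_left (by norm_num)
    rw [← mk_hor_ver (L (mk a 0)), e4]; rfl
  have h2 : ∀ s, L (mk 0 s) = mk 0 (ver (L (mk 0 s))) := by
    intro s
    have hs : (0 : ℝ) < √2 := by positivity
    -- Likewise the square of `(0, s)` is its dilation by `√2`, so the horizontal part `h` satisfies
    -- `2h = √2 h`.
    have e : mk (0 : Hor n) s * mk 0 s = dil √2 (mk 0 s) := by
      rw [mk_mul_mk, dil_mk, rho_self, Real.sq_sqrt two_pos.le, two_smul]; simp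
    have e2 := congrArg L e
    rw [map_mul, hL _ hs, ← mk_hor_ver (L (mk 0 s)), mk_mul_mk, dil_mk, rho_self] at e2
    have e3 := (mk_inj e2).1
    rw [← two_smul ℝ, ← sub_eq_zero, ← sub_smul] at e3
    have e4 : hor (L (mk 0 s)) = 0 := by
      refine (smul_eq_zero.1 e3).resolve_left fun h => ?_
      nlinarith [Real.sq_sqrt (two_pos (α := ℝ)).le]
    rw [← mk_hor_ver (L (mk 0 s)), e4]; rfl
  set α : Hor n → Hor n := fun a => hor (L (mk a 0))
  set β : Ver → Ver := fun s => ver (L (mk 0 s))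
  have h1' : ∀ a, L (mk a 0) = mk (α a) 0 := h1
  have h2' : ∀ s, L (mk 0 s) = mk 0 (β s) := h2
  have h3 : ∀ a s, L (mk a s) = mk (α a) (β s) := by
    intro a s
    have e : mk a s = mk a 0 * mk 0 s := by rw [mk_mul_mk, rho_zero_right]; simp
    rw [e, map_mul, h1', h2', mk_mul_mk, rho_zero_right]; simp
  have h4 : ∀ a b, mk (α a + α b) ((1 / 2 : ℝ) • rho (α a) (α b))
      = mk (α (a + b)) (β ((1 / 2 : ℝ) • rho a b)) := by
    intro a b
    have e := congrArg L (mk_mul_mk a b 0 0)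
    rw [map_mul, h1', h1', mk_mul_mk, h3] at e
    simpa using e
  have hβ : ∀ s t, β (s + t) = β s + β t := by
    intro s t
    have e := congrArg L (mk_mul_mk (0 : Hor n) 0 s t)
    rw [map_mul, h2', h2', mk_mul_mk, rho_self, smul_zero, add_zero, add_zero, add_zero, h2'] at e
    exact (mk_inj e).2.symm
  have hαr : ∀ r : ℝ, 0 < r → ∀ a, α (r • a) = r • α a := by
    intro r hr a
    have e := hL r hr (mk a 0)
    rw [dil_mk, smul_zero, h1', h1', dil_mk] at e
    exact (mk_inj e).1
  have hβr : ∀ r : ℝ, 0 < r → ∀ s, β (r • s) = r • β s := by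
    intro r hr s
    have e := hL √r (Real.sqrt_pos.2 hr) (mk 0 s)
    rw [dil_mk, smul_zero, h2', h2', dil_mk, Real.sq_sqrt hr.le] at e
    exact (mk_inj e).2
  let A := linearOfPosHomogeneous α (fun a b => (mk_inj (h4 a b)).1.symm) hαr
  let φ := linearOfPosHomogeneous β hβ hβr
  have hA : Function.Injective A := fun a b hab => by
    refine (mk_inj (hb (a₁ := mk a 0) (a₂ := mk b 0) ?_)).1
    rw [h1', h1']
    exact congrArg (fun x => mk x 0) hab
  have hφ : Function.Injective φ := fun s t hst => by
    refine (mk_inj (hb (a₁ := mk 0 s) (a₂ := mk 0 t) ?_)).2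
    rw [h2', h2']
    exact congrArg (fun x => mk 0 x) hst
  refine ⟨(LinearEquiv.ofInjectiveEndo A hA).toContinuousLinearEquiv,
    (LinearEquiv.ofInjectiveEndo φ hφ).toContinuousLinearEquiv, h1', h2', fun v w => ?_⟩
  have e := (mk_inj (h4 v w)).2
  rw [hβr _ (by norm_num)] at e
  exact smul_right_injective Ver (by norm_num : (1 / 2 : ℝ) ≠ 0) e

end Algebra

theorem locallyIntegrable_comp_add_right {E W : Type*} [NormedAddCommGroup E] [NormedSpace ℝ E]
    [MeasureSpace E] [BorelSpace E] [FiniteDimensional ℝ E] [(volume : Measure E).IsAddHaarMeasure]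
    [NormedAddCommGroup W] {u : E → W} (hu : LocallyIntegrable u) (c : E) :
    LocallyIntegrable (fun x => u (x + c)) := by
  have : ProperSpace E := FiniteDimensional.proper ℝ E
  rw [locallyIntegrable_iff]
  intro K hK
  have hK' : IsCompact ((fun x => x + c) '' K) := hK.image (by fun_prop)
  have h := (measurePreserving_add_right (volume : Measure E) c).restrict_preimage
    hK'.measurableSet
  have h2 : IntegrableOn (fun x => u (x + c)) ((fun x => x + c) ⁻¹' ((fun x => x + c) '' K)) :=
    h.integrable_comp_of_integrable (hu.integrableOn_isCompact hK')
  exact h2.mono_set (Set.subset_preimage_image _ _)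

/-! ### Horizontal fields and central increments -/

section Group

variable {n : ℕ}

instance : FiniteDimensional ℝ (QHeis n) := inferInstanceAs (FiniteDimensional ℝ (Hor n × Ver))

instance : (volume : Measure (QHeis n)).IsAddHaarMeasure :=
  inferInstanceAs ((volume : Measure (Hor n)).prod (volume : Measure Ver)).IsAddHaarMeasure

/-- The projection to the horizontal coordinates as a linear map. -/
def horL : QHeis n →L[ℝ] Hor n := ContinuousLinearMap.fst ℝ (Hor n) Ver

/-- The inclusion of the centre as a linear map. -/
def vertL : Ver →L[ℝ] QHeis n := ContinuousLinearMap.inr ℝ (Hor n) Ver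

theorem hor_add_vertL (g : QHeis n) (c : Ver) : hor (g + vertL c) = hor g := add_zero (hor g)

/-- `a ↦ ρ(a, w) / 2` as a linear map. -/
def halfRho (w : Hor n) : Hor n →L[ℝ] Ver :=
  LinearMap.toContinuousLinearMap
    { toFun := fun a => (1 / 2 : ℝ) • rho a w
      map_add' := fun a b => by rw [rho_add_left, smul_add]
      map_smul' := fun r a => by rw [rho_smul_left, smul_comm]; rfl }

theorem halfRho_apply (w a : Hor n) : halfRho w a = (1 / 2 : ℝ) • rho a w := rfl

theorem leftField_eq (w : Hor n) (g : QHeis n) :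
    leftField w g = mk w 0 + vertL (halfRho w (horL g)) :=
  Prod.ext (add_zero w).symm (zero_add _).symm

theorem mk_eq_add (w : Hor n) (c : Ver) : mk w c = mk w 0 + vertL c :=
  Prod.ext (add_zero w).symm (zero_add _).symm

theorem leftField_add_vertL (w : Hor n) (g : QHeis n) (c : Ver) :
    leftField w (g + vertL c) = leftField w g := by
  rw [leftField, leftField, hor_add_vertL]

theorem contDiff_leftField (w : Hor n) : ContDiff ℝ ∞ (leftField w : QHeis n → QHeis n) := by
  rw [show (leftField w : QHeis n → QHeis n) = fun g => mk w 0 + vertL (halfRho w (horL g)) from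
    funext (leftField_eq w)]
  exact contDiff_const.add
    (vertL.contDiff.comp ((halfRho w).contDiff.comp (horL (n := n)).contDiff))

theorem hasFDerivAt_leftField (w : Hor n) (g : QHeis n) :
    HasFDerivAt (leftField w) (vertL.comp ((halfRho w).comp horL)) g := by
  rw [show (leftField w : QHeis n → QHeis n) = fun g => mk w 0 + vertL (halfRho w (horL g)) from
    funext (leftField_eq w)]
  exact (vertL.comp ((halfRho w).comp (horL (n := n)))).hasFDerivAt.const_add _

variable {W : Type*} [NormedAddCommGroup W] [NormedSpace ℝ W]

theorem hasCompactSupport_fderiv_apply {φ : QHeis n → ℝ} (hc : HasCompactSupport φ)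
    (X : QHeis n → QHeis n) : HasCompactSupport fun x => fderiv ℝ φ x (X x) :=
  (hc.fderiv (𝕜 := ℝ)).mono fun x hx h0 => hx (by simp [h0])

/-- Second-order terms cancel by symmetry; the derivatives of the coefficients leave `ρ(v, w)/2 -
ρ(w, v)/2`. -/
theorem fderiv_commutator {φ : QHeis n → ℝ} (hφ : ContDiff ℝ ∞ φ) (v w : Hor n) (x : QHeis n) :
    fderiv ℝ (fun y => fderiv ℝ φ y (leftField w y)) x (leftField v x)
      - fderiv ℝ (fun y => fderiv ℝ φ y (leftField v y)) x (leftField w x)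
      = fderiv ℝ φ x (vertL (rho v w)) := by
  have hd : Differentiable ℝ (fderiv ℝ φ) :=
    (hφ.fderiv_right (m := ∞) (by simp)).differentiable (by simp)
  have hD := (hd x).hasFDerivAt
  have hsymm := second_derivative_symmetric
    (fun z => (hφ.differentiable (by simp) z).hasFDerivAt) hD (leftField v x) (leftField w x)
  have hX : ∀ w : Hor n, HasFDerivAt (fun y => fderiv ℝ φ y (leftField w y)) _ x := fun w =>
    hD.clm_apply (hasFDerivAt_leftField w x)
  rw [(hX w).fderiv, (hX v).fderiv]
  have hhor : ∀ w : Hor n, horL (leftField w x) = w := fun _ => rfl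
  simp only [_root_.add_apply, ContinuousLinearMap.comp_apply,
    ContinuousLinearMap.flip_apply, hhor, hsymm, halfRho_apply, rho_swap v w]
  rw [add_sub_add_right_eq_sub, ← map_sub, ← map_sub, smul_neg, sub_neg_eq_add, ← add_smul]
  norm_num

/-- Every central vector is a bracket of two horizontal fields, so two integrations by parts
suffice. -/
theorem HasWeakDerivAlong.vertL_zero (hn : 0 < n) {q : QHeis n → W} (hq : LocallyIntegrable q)
    (h : ∀ w, HasWeakDerivAlong (leftField w) q fun _ => 0) (c : Ver) :
    HasWeakDerivAlong (fun _ => vertL c) q fun _ => 0 := by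
  intro φ hφ hc
  obtain ⟨v, w, rfl⟩ := exists_rho_eq hn c
  have hsm : ∀ w : Hor n, ContDiff ℝ ∞ fun y => fderiv ℝ φ y (leftField w y) := fun w =>
    (hφ.fderiv_right (m := ∞) (by simp)).clm_apply (contDiff_leftField w)
  have hcs : ∀ w : Hor n, HasCompactSupport fun y => fderiv ℝ φ y (leftField w y) := fun w =>
    hasCompactSupport_fderiv_apply hc _
  have hint : ∀ v w : Hor n, Integrable fun x =>
      fderiv ℝ (fun y => fderiv ℝ φ y (leftField w y)) x (leftField v x) • q x := fun v w =>
    hq.integrable_smul_left_of_hasCompactSupport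
      (((hsm w).continuous_fderiv (by simp)).clm_apply (contDiff_leftField v).continuous)
      (hasCompactSupport_fderiv_apply (hcs w) _)
  have h1 := h v _ (hsm w) (hcs w)
  have h2 := h w _ (hsm v) (hcs v)
  simp only [← fderiv_commutator hφ v w, sub_smul]
  rw [integral_sub (hint v w) (hint w v), h1, h2]
  simp

/-- The constant field is `leftField w` minus a central field whose coefficients `r k` are constant
along the centre. They can therefore be absorbed into the test function. -/
theorem HasWeakDerivAlong.horizontal_zero (hn : 0 < n) {q : QHeis n → W}
    (hq : LocallyIntegrable q)
    (h : ∀ w, HasWeakDerivAlong (leftField w) q fun _ => 0) (w : Hor n) :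
    HasWeakDerivAlong (fun _ => mk w 0) q fun _ => 0 := by
  intro φ hφ hc
  let e : Fin 3 → Ver := fun k => EuclideanSpace.single k 1
  let r : Fin 3 → QHeis n →L[ℝ] ℝ := fun k =>
    (EuclideanSpace.proj k).comp ((halfRho w).comp horL)
  have hrv : ∀ k c, r k (vertL c) = 0 := fun k c => by
    have : horL (vertL c : QHeis n) = 0 := rfl
    simp [r, this]
  have hvert : ∀ x : QHeis n, halfRho w (horL x) = ∑ k, r k x • e k := by
    intro x
    ext j
    simp [r, e, Pi.single_apply]
  have hsm : ∀ k, ContDiff ℝ ∞ fun x => r k x * φ x := fun k => (r k).contDiff.mul hφ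
  have hcs : ∀ k, HasCompactSupport fun x => r k x * φ x := fun k => hc.mul_left
  have hder : ∀ k x, fderiv ℝ (fun x => r k x * φ x) x (vertL (e k))
      = r k x * fderiv ℝ φ x (vertL (e k)) := by
    intro k x
    rw [fderiv_fun_mul (r k).differentiableAt (hφ.differentiable (by simp) x)]
    simp [hrv]
  have hsplit : ∀ x, fderiv ℝ φ x (mk w 0) = fderiv ℝ φ x (leftField w x)
      - ∑ k, fderiv ℝ (fun x => r k x * φ x) x (vertL (e k)) := by
    intro x
    rw [leftField_eq, hvert]
    simp only [map_add, map_sum, map_smul, hder, smul_eq_mul]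
    ring
  have hzero : ∀ k, ∫ x, fderiv ℝ (fun x => r k x * φ x) x (vertL (e k)) • q x = 0 := fun k => by
    simpa using HasWeakDerivAlong.vertL_zero hn hq h (e k) _ (hsm k) (hcs k)
  have hint : ∀ {ψ : QHeis n → ℝ}, ContDiff ℝ ∞ ψ → HasCompactSupport ψ →
      ∀ {X : QHeis n → QHeis n}, Continuous X → Integrable fun x => fderiv ℝ ψ x (X x) • q x :=
    fun {ψ} hψ hψc {X} hX => hq.integrable_smul_left_of_hasCompactSupport
      ((hψ.continuous_fderiv (by simp)).clm_apply hX) (hasCompactSupport_fderiv_apply hψc X)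
  simp only [hsplit, sub_smul, Finset.sum_smul]
  rw [integral_sub (hint hφ hc (contDiff_leftField w).continuous)
    (integrable_finsetSum _ fun k _ => hint (hsm k) (hcs k) continuous_const),
    integral_finsetSum _ fun k _ => hint (hsm k) (hcs k) continuous_const, h w φ hφ hc]
  simp [hzero]

/-- A locally integrable function whose weak derivatives along all left-invariant horizontal fields
vanish is constant. -/
theorem ae_eq_const_of_leftField_zero [CompleteSpace W] (hn : 0 < n) {q : QHeis n → W}
    (hq : LocallyIntegrable q) (h : ∀ w, HasWeakDerivAlong (leftField w) q fun _ => 0) :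
    ∃ c, q =ᵐ[volume] fun _ => c := by
  refine ae_eq_const_of_hasWeakDerivAlong_zero hq fun ξ φ hφ hc => ?_
  have hint : ∀ η : QHeis n, Integrable fun x => fderiv ℝ φ x η • q x := fun η =>
    hq.integrable_smul_left_of_hasCompactSupport
      ((hφ.continuous_fderiv (by simp)).clm_apply continuous_const)
      (hasCompactSupport_fderiv_apply hc fun _ => η)
  have h1 := HasWeakDerivAlong.horizontal_zero hn hq h (hor ξ) φ hφ hc
  have h2 := HasWeakDerivAlong.vertL_zero hn hq h (ver ξ) φ hφ hc
  rw [← mk_hor_ver ξ, mk_eq_add]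
  simp only [map_add, add_smul]
  rw [integral_add (hint _) (hint _), h1, h2]
  simp

/-- The increments of the central coordinate of a Sobolev contact lift along the centre are
constant. -/
theorem IsSobolevContact.exists_vertical_increment (hn : 0 < n) {p : ℝ≥0∞} (hp : 1 ≤ p)
    {f : Hor n → Hor n} {F : QHeis n → QHeis n} (hF : IsSobolevContact p F) (hlift : IsLift F f)
    (c : Ver) : ∃ d : Ver, ∀ᵐ g, ver (F (g + vertL c)) - ver (F g) = d := by
  obtain ⟨-, hver, hw⟩ := hF
  have hl := hver.locallyIntegrable hp
  have hlc := locallyIntegrable_comp_add_right hl (vertL c)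
  refine ae_eq_const_of_leftField_zero hn (hlc.sub hl) fun w => ?_
  obtain ⟨a, b, ha, hb, hFa, hFb, hab⟩ := hw w
  have hX : ∀ g : QHeis n, leftField w (g + vertL c) = leftField w g := fun g =>
    leftField_add_vertL w g c
  have hhor : ∀ g, hor (F (g + vertL c)) = hor (F g) := fun g => by
    rw [hlift, hlift, hor_add_vertL]
  have ha' := hFa.comp_add_right hX
  simp only [hhor] at ha'
  have hal := ha.locallyIntegrable hp
  have hbl := hb.locallyIntegrable hp
  -- By uniqueness of weak derivatives `a` is centrally invariant; the contact equation then gives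
  -- the same for `b`.
  have hainv := HasWeakDerivAlong.ae_eq hal (locallyIntegrable_comp_add_right hal _) hFa ha'
  have habc := (measurePreserving_add_right (volume : Measure (QHeis n))
    (vertL c)).quasiMeasurePreserving.ae hab
  have hbinv : ∀ᵐ g, b (g + vertL c) - b g = 0 := by
    filter_upwards [hainv, hab, habc] with g h1 h2 h3
    rw [(mk_inj h2).2, (mk_inj h3).2, hhor, ← h1, sub_self]
  exact ((hFb.comp_add_right hX).sub (contDiff_leftField w).continuous hlc
    (locallyIntegrable_comp_add_right hbl _) hl hbl hFb).congr_ae hbinv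

end Group

/-! ### Pansu differentials of the lift -/

section Main

variable {n : ℕ}

theorem mul_dil_mk (g : QHeis n) (r : ℝ) (w : Hor n) :
    hor (g * dil r (mk w 0)) = hor g + r • w := rfl

theorem mul_dil_vert (g : QHeis n) (r : ℝ) (s : Ver) :
    g * dil r (mk 0 s) = g + vertL (r ^ 2 • s) := by
  refine Prod.ext ?_ ?_
  · change hor g + r • (0 : Hor n) = hor g + 0
    rw [smul_zero]
  · change ver g + r ^ 2 • s + (1 / 2 : ℝ) • rho (hor g) (r • (0 : Hor n)) = ver g + r ^ 2 • s
    rw [smul_zero, rho_zero_right, smul_zero, add_zero]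

theorem continuous_hor : Continuous (hor : QHeis n → Hor n) := continuous_fst

theorem continuous_ver : Continuous (ver : QHeis n → Ver) := continuous_snd

theorem HasPansuDerivAt.tendsto {F : QHeis n → QHeis n} {L : QHeis n →* QHeis n} {g : QHeis n}
    (h : HasPansuDerivAt F L g) (x : QHeis n) :
    Tendsto (fun r : ℝ => dil r⁻¹ ((F g)⁻¹ * F (g * dil r x))) (𝓝[>] 0) (𝓝 (L x)) :=
  (h.2 {x} isCompact_singleton).tendsto_at (Set.mem_singleton x)

/-- The horizontal part of the Pansu quotient is the right difference quotient of `f`; the left one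
is the right one in direction `-w`, negated. -/
theorem HasPansuDerivAt.hasLineDerivAt {f : Hor n → Hor n} {F : QHeis n → QHeis n}
    {L : QHeis n →* QHeis n} {g : QHeis n} (h : HasPansuDerivAt F L g) (hlift : IsLift F f)
    {A : Hor n →ₗ[ℝ] Hor n} (hA : ∀ a, L (mk a 0) = mk (A a) 0) (w : Hor n) :
    HasLineDerivAt ℝ f (A w) (hor g) w := by
  have hright : ∀ w, Tendsto (fun r : ℝ => r⁻¹ • (f (hor g + r • w) - f (hor g))) (𝓝[>] 0)
      (𝓝 (A w)) := by
    intro w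
    have h1 := (continuous_hor.tendsto _).comp (h.tendsto (mk w 0))
    rw [hA] at h1
    refine h1.congr fun r => ?_
    change r⁻¹ • (-hor (F g) + hor (F (g * dil r (mk w 0)))) = _
    rw [hlift, hlift, mul_dil_mk, neg_add_eq_sub]
  rw [hasLineDerivAt_iff_tendsto_slope_zero, ← Set.Iio_union_Ioi, nhdsWithin_union, tendsto_sup]
  refine ⟨?_, hright w⟩
  have hneg : Tendsto (fun r : ℝ => -r) (𝓝[<] 0) (𝓝[>] 0) := by
    simpa using tendsto_neg_nhdsLT (a := (0 : ℝ))
  have h1 := ((hright (-w)).comp hneg).neg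
  rw [map_neg, neg_neg] at h1
  refine h1.congr fun r => ?_
  simp only [Function.comp_apply, smul_neg, neg_smul, neg_neg, inv_neg]

/-- Central translation leaves `hor F` unchanged, so the `ρ` term of the group law drops out. -/
theorem HasPansuDerivAt.tendsto_ver {f : Hor n → Hor n} {F : QHeis n → QHeis n}
    {L : QHeis n →* QHeis n} {g : QHeis n} (h : HasPansuDerivAt F L g) (hlift : IsLift F f)
    (s : Ver) :
    Tendsto (fun r : ℝ => r⁻¹ ^ 2 • (ver (F (g + vertL (r ^ 2 • s))) - ver (F g))) (𝓝[>] 0)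
      (𝓝 (ver (L (mk 0 s)))) := by
  refine ((continuous_ver.tendsto _).comp (h.tendsto (mk 0 s))).congr fun r => ?_
  rw [← mul_dil_vert]
  change r⁻¹ ^ 2 • (-ver (F g) + ver (F (g * dil r (mk 0 s)))
    + (1 / 2 : ℝ) • rho (-hor (F g)) (hor (F (g * dil r (mk 0 s))))) = _
  rw [hlift (g * dil r (mk 0 s)), mul_dil_vert, hor_add_vertL, ← hlift g, rho_neg_self,
    smul_zero, add_zero, neg_add_eq_sub]

/-- The Pansu differential of a Sobolev contact lift acts on the centre in the same way at almost
every point. -/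
theorem exists_vertical_differential (hn : 0 < n) {p : ℝ≥0∞} (hp : 1 ≤ p)
    {f : Hor n → Hor n} {F : QHeis n → QHeis n} (hF : IsSobolevContact p F) (hlift : IsLift F f)
    (s : Ver) :
    ∃ d : ℕ → Ver, ∀ᵐ g, ∀ L : QHeis n →* QHeis n, HasPansuDerivAt F L g →
      Tendsto d atTop (𝓝 (ver (L (mk 0 s)))) := by
  have hr : Tendsto (fun k : ℕ => 1 / ((k : ℝ) + 1)) atTop (𝓝[>] 0) :=
    tendsto_nhdsWithin_iff.2 ⟨tendsto_one_div_add_atTop_nhds_zero_nat,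
      Eventually.of_forall fun _ => Set.mem_Ioi.2 Nat.one_div_pos_of_nat⟩
  -- Restricting to `r = 1/(k+1)` leaves countably many null sets, and the increments `e k` do not
  -- depend on the point.
  choose e he using fun k : ℕ =>
    hF.exists_vertical_increment hn hp hlift ((1 / ((k : ℝ) + 1)) ^ 2 • s)
  refine ⟨fun k => (1 / ((k : ℝ) + 1))⁻¹ ^ 2 • e k, ?_⟩
  filter_upwards [ae_all_iff.2 he] with g hg L hL
  refine ((hL.tendsto_ver hlift s).comp hr).congr fun k => ?_
  simp only [Function.comp_apply, hg]

/-- A Sobolev contact lift with bijective Pansu differentials gives `f` classical derivatives that scale `ρ`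
by one and the same automorphism of the centre. -/
theorem exists_scaling (hn : 0 < n) {p : ℝ≥0∞} (hp : 1 ≤ p)
    {f : Hor n → Hor n} {F : QHeis n → QHeis n} (hF : IsSobolevContact p F) (hlift : IsLift F f)
    (hrank : ∀ᵐ g : QHeis n, ∃ L : QHeis n →* QHeis n,
      HasPansuDerivAt F L g ∧ Function.Bijective L) :
    ∃ φ : Ver ≃L[ℝ] Ver, ∀ᵐ x : Hor n, ∃ A : Hor n ≃L[ℝ] Hor n,
      (∀ w, HasLineDerivAt ℝ f (A w) x w) ∧ ∀ v w, rho (A v) (A w) = φ (rho v w) := by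
  have hgood : ∀ᵐ g : QHeis n, ∃ (A : Hor n ≃L[ℝ] Hor n) (φ : Ver ≃L[ℝ] Ver)
      (L : QHeis n →* QHeis n), HasPansuDerivAt F L g ∧
      (∀ w, HasLineDerivAt ℝ f (A w) (hor g) w) ∧ (∀ s, L (mk 0 s) = mk 0 (φ s)) ∧
      ∀ v w, rho (A v) (A w) = φ (rho v w) := by
    filter_upwards [hrank] with g ⟨L, hL, hb⟩
    obtain ⟨A, φ, hA, hφ, hρ⟩ := exists_graded_of_bijective L hL.1 hb.1
    exact ⟨A, φ, L, hL, hL.hasLineDerivAt hlift (A := A.toLinearEquiv.toLinearMap) hA, hφ, hρ⟩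
  choose d hd using fun s => exists_vertical_differential hn hp hF hlift s
  -- The null set in `hd` depends on `s`; a basis needs only finitely many of them.
  let e : Module.Basis (Fin 3) ℝ Ver := (EuclideanSpace.basisFun (Fin 3) ℝ).toBasis
  have hde := ae_all_iff.2 fun k : Fin 3 => hd (e k)
  obtain ⟨g₀, ⟨-, φ, L₀, hL₀, -, hφ, -⟩, hg₀⟩ := (hgood.and hde).exists
  refine ⟨φ, ?_⟩
  have hall : ∀ᵐ g : QHeis n, ∃ A : Hor n ≃L[ℝ] Hor n,
      (∀ w, HasLineDerivAt ℝ f (A w) (hor g) w) ∧ ∀ v w, rho (A v) (A w) = φ (rho v w) := by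
    filter_upwards [hgood, hde] with g ⟨A, ψ, L, hL, hA, hψ, hρ⟩ hg
    refine ⟨A, hA, fun v w => ?_⟩
    have hψφ : (ψ : Ver →ₗ[ℝ] Ver) = (φ : Ver →ₗ[ℝ] Ver) := by
      refine e.ext fun k => ?_
      have := tendsto_nhds_unique (hg k L hL) (hg₀ k L₀ hL₀)
      rw [hψ, hφ] at this
      exact this
    rw [hρ]
    exact congrArg (fun T : Ver →ₗ[ℝ] Ver => T (rho v w)) hψφ
  -- The conclusion involves `g` only through `hor g`, so Fubini brings it down to almost every `x`.
  have hprod := Measure.ae_ae_of_ae_prod (μ := (volume : Measure (Hor n)))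
    (ν := (volume : Measure Ver)) hall
  filter_upwards [hprod] with x hx
  exact hx.exists.choose_spec

end Main

end QuatHeis

end

theorem theorem5p2 (n : ℕ) (p : ℝ≥0∞) (hp : 1 ≤ p)
    (f : QuatHeis.Hor n → QuatHeis.Hor n) (hf : Continuous f) (hfS : QuatHeis.IsSobolev p f)
    (F : QuatHeis.QHeis n → QuatHeis.QHeis n) (hF : QuatHeis.IsSobolevContact p F)
    (hlift : QuatHeis.IsLift F f)
    (hrank : ∀ᵐ g : QuatHeis.QHeis n, ∃ L : QuatHeis.QHeis n →* QuatHeis.QHeis n,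
      QuatHeis.HasPansuDerivAt F L g ∧ Function.Bijective L) :
    ∃ (A : QuatHeis.Hor n ≃L[ℝ] QuatHeis.Hor n) (b : QuatHeis.Hor n)
      (φ : QuatHeis.Ver ≃L[ℝ] QuatHeis.Ver),
      (∀ x, f x = A x + b) ∧
      (∀ v w, QuatHeis.rho (A v) (A w) = φ (QuatHeis.rho v w)) ∧
      ∀ x q, ∃ U : QuatHeis.Hor n ≃ₗᵢ[ℝ] QuatHeis.Hor n,
        (∀ v, fderiv ℝ f x v = U (fderiv ℝ f q v)) ∧
        ∀ v w, QuatHeis.rho (U v) (U w) = QuatHeis.rho v w := by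
  open QuatHeis in
  suffices h : ∃ (A : Hor n ≃L[ℝ] Hor n) (b : Hor n) (φ : Ver ≃L[ℝ] Ver),
      (∀ x, f x = A x + b) ∧ ∀ v w, rho (A v) (A w) = φ (rho v w) by
    obtain ⟨A, b, φ, hfA, hρ⟩ := h
    have hd : ∀ x, fderiv ℝ f x = A := fun x => by
      rw [funext hfA, fderiv_add_const]
      exact A.fderiv
    -- Once `f` is affine its derivative is constant, so the isometry is the identity.
    exact ⟨A, b, φ, hfA, hρ, fun x q => ⟨LinearIsometryEquiv.refl ℝ _,
      fun v => by rw [hd, hd]; rfl, fun _ _ => rfl⟩⟩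
  -- For `n = 0` brackets do not span the centre, but `ℝ^{4n}` is a point.
  rcases Nat.eq_zero_or_pos n with rfl | hn
  · refine ⟨.refl ℝ _, 0, .refl ℝ _, fun x => Subsingleton.elim _ _, fun v w => ?_⟩
    rfl
  obtain ⟨φ, hφ⟩ := exists_scaling hn hp hF hlift hrank
  obtain ⟨x₀, A₀, hA₀, hρ₀⟩ := hφ.exists
  choose v hvp hv using hfS.2
  have hvl : ∀ w, LocallyIntegrable (v w) := fun w => (hvp w).locallyIntegrable hp
  let A₀L : Hor n →ₗ[ℝ] Hor n := A₀.toLinearEquiv.toLinearMap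
  let A₀S : Hor n →ₗ[ℝ] Hor n := A₀.symm.toLinearEquiv.toLinearMap
  let P : (Hor n →ₗ[ℝ] Hor n) → (Hor n →L[ℝ] Hor n) := fun K =>
    LinearMap.toContinuousLinearMap (A₀L ∘ₗ K ∘ₗ A₀S)
  have hPapp : ∀ K y, P K y = A₀ (K (A₀.symm y)) := fun _ _ => rfl
  have hline : ∀ {x} {A : Hor n ≃L[ℝ] Hor n} {w}, HasLineDerivAt ℝ f (A w) x w →
      v w x = lineDeriv ℝ f x w → v w x = A w := fun h h' => h'.trans h.lineDeriv
  have hae := fun w => (hv w).ae_eq_lineDeriv hf (hvl w)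
  have hinter : ∀ {K : Hor n →ₗ[ℝ] Hor n} {k : Fin 3}, (∀ a b, rho (K a) b 0 = rho a b k) →
      ∀ w, v (K w) =ᵐ[volume] fun x => P K (v w x) := by
    intro K k hK w
    filter_upwards [hφ, hae w, hae (K w)] with x ⟨A, hA, hρ⟩ h1 h2
    rw [hline (hA _) h1, hline (hA _) h2, hPapp]
    have hsymm : ∀ a b, rho (A₀.symm a) (A₀.symm b) = φ.symm (rho a b) := fun a b => by
      rw [ContinuousLinearEquiv.eq_symm_apply, ← hρ₀]; simp
    -- `A₀⁻¹ A` preserves `ρ` because both factors scale it by the same `φ`.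
    have := map_comm_of_rho_eq (B := fun a => A₀.symm (A a)) (K := K)
      (A₀.symm.surjective.comp A.surjective)
      (fun a b => by rw [hsymm, hρ, ContinuousLinearEquiv.symm_apply_apply]) hK w
    rw [← this, ContinuousLinearEquiv.apply_symm_apply]
  obtain ⟨T, hT⟩ := exists_eq_add_of_intertwining hf hvl hv (P := P quatK) (P' := P quatK')
    (fun y hy => by
      simp only [hPapp, ContinuousLinearEquiv.symm_apply_apply] at hy
      simpa using eq_zero_of_quatK_comm (A₀.injective hy)) (hinter rho_quatK) (hinter rho_quatK')
  refine ⟨A₀, f 0, φ, fun x => ?_, hρ₀⟩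
  have hTd : HasFDerivAt f T x₀ := by
    rw [funext hT]
    exact T.hasFDerivAt.add_const _
  -- `T = A₀`, since both give the line derivatives of `f` at `x₀`.
  rw [hT x, ← (hA₀ x).lineDeriv, (hTd.hasLineDerivAt x).lineDeriv]
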